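/- **Setting.** Let $\mathcal X,\Phi$ be standard Borel spaces (Polish spaces with their Borel $\sigma$-algebras), let $\mathcal Y=\mathcal X\times\Phi$ carry the product $\sigma$-algebra, and fix a Polish topology on $\mathcal Y$ whose Borel $\sigma$-algebra is the product $\sigma$-algebra (for instance the product topology). Let $\nu$ be a probability measure on $\mathcal X$. Let $\mathcal I\subseteq\mathbb R^s$ carry the trace of the Borel $\sigma$-algebra, and let $\|\cdot\|$ be the Euclidean norm on $\mathbb R^s$. Let $(P_\gamma)_{\gamma\in\mathcal I}$ be a family of Markov transition kernels on $\mathcal Y$ such that $(y,\gamma,A)\mapsto P_\gamma(y,A)$ is a transition kernel from $\mathcal Y\times\mathcal I$ to $\mathcal Y$, and let $(\pi_\gamma)_{\gamma\in\mathcal I}$ be probability measures on $\mathcal Y$ such that $\pi_\gamma$ is invariant for $P_\gamma$ and has first marginal $\nu$, i.e. $\pi_\gamma(B\times\Phi)=\nu(B)$ for all measurable $B\subseteq\mathcal X$. Let $d:\mathcal Y\times\mathcal Y\to[0,\infty)$ be distance-like: symmetric, $d(x,y)=0\iff x=y$, and lower semicontinuous. For probability measures $\mu_1,\mu_2$ on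 $\mathcal Y$ let $\mathcal W(\mu_1,\mu_2)=\inf_\xi\int d(x,y)\,\xi(dx,dy)$, the infimum being over all couplings $\xi$ of $\mu_1,\mu_2$. For a transition kernel $Q$ on $\mathcal Y$ put $\tau(Q)=\sup_{y_1\ne y_2}\mathcal W(Q(y_1,\cdot),Q(y_2,\cdot))/d(y_1,y_2)$. Assume: 1. (Contraction) There are $M\in[1,\infty)$, $\tau\in[0,1)$ and an integer $k_0\ge1$ such that $\tau(P_\gamma)\le M$ and $\tau(P_\gamma^{k_0})\le\tau$ for all $\gamma\in\mathcal I$. 2. (Bounded eccentricity) There is $K\in(0,\infty)$ with $\int d(y,y')\,\pi_\gamma(dy')\le K$ for all $\gamma\in\mathcal I$, $y\in\mathcal Y$. 3. $f:\mathcal X\to\mathbb R$ is measurable, and $h(x,\varphi)=f(x)$ is bounded on $\mathcal Y$ and Lipschitz with respect to $d$, i.e. $|h(y)-h(y')|\le L\,d(y,y')$ for some $L\in(0,\infty)$ and all $y,y'\in\mathcal Y$. 4. (Lipschitz Poisson solutions) The functions $u_\gamma(y)=\sum_{\ell=0}^\infty\bigl(P_\gamma^\ell h(y)-\pi_\gamma(h)\bigr)$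 satisfy, for some $\Lambda\in(0,\infty)$, $\sup_{y\in\mathcal Y}|u_\gamma(y)-u_{\gamma'}(y)|\le\Lambda\|\gamma-\gamma'\|$ for all $\gamma,\gamma'\in\mathcal I$. Let $\beta\in(0,1)$, $T_m=\sum_{j=1}^m\lceil j^\beta\rceil$ for $m\ge0$ (so $T_0=0$), and let $(Y_n,\Gamma_n)_{n\ge0}$ be an adaptive increasingly rare (AIR) MCMC chain: random variables on a probability space with values in $\mathcal Y\times\mathcal I$ such that - $(Y_0,\Gamma_0)\equiv(y_0,\gamma_0)$ is deterministic; - with $\mathcal F_n=\sigma(Y_0,\dots,Y_n,\Gamma_0,\dots,\Gamma_n)$, for every $n\ge0$ and measurable $B\subseteq\mathcal Y$, $\mathbb P[Y_{n+1}\in B\mid\mathcal F_n]=P_{\Gamma_n}(Y_n,B)$ almost surely; - $\Gamma_n=U_n(Y_0,\dots,Y_n,\Gamma_0,\dots,\Gamma_{n-1})$ for measurable maps $U_n:\mathcal Y^{n+1}\times\mathcal I^n\to\mathcal I$; - $\Gamma$ is constant on each block of times $\{T_j,\dots,T_{j+1}-1\}$. Assume moreover that for some $\rho\in(0,1)$ the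 parameters are $\rho$-waning: $\lim_{k\to\infty}k^{-\rho}\sum_{j=1}^k\|\Gamma_{T_j}-\Gamma_{T_{j-1}}\|=0$ almost surely. Write $Y_n=(X_n,\phi_n)$. **Theorem.** If $\beta\ge2\rho-1$, then for every $\varepsilon>0$, almost surely, $$\lim_{n\to\infty}\frac{1}{\sqrt n\,(\log n)^{1/2+\varepsilon}}\sum_{j=1}^n\bigl(f(X_j)-\nu(f)\bigr)=0,\qquad \nu(f)=\int f\,d\nu .$$ -/

import Mathlib

open MeasureTheory ProbabilityTheory Filter Topology
open scoped ENNReal NNReal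

namespace AIRMCMC

section Distance

variable {S : Type*} [MeasurableSpace S]

/-- A distance-like function on a topological space `S`: a (finite, nonnegative) symmetric function
that vanishes exactly on the diagonal and is lower semicontinuous on `S × S`. -/
structure IsDistanceLike [TopologicalSpace S] (d : S → S → ℝ≥0) : Prop where
  symm : ∀ x y, d x y = d y x
  eq_zero_iff : ∀ x y, d x y = 0 ↔ x = y
  lowerSemicontinuous : LowerSemicontinuous (fun p : S × S => d p.1 p.2)

/-- The set of couplings of two measures. -/
def couplings (μ₁ μ₂ : Measure S) : Set (Measure (S × S)) :=
  {ξ | ξ.map Prod.fst = μ₁ ∧ ξ.map Prod.snd = μ₂}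

/-- The Wasserstein-like function associated with `d`. -/
noncomputable def wasserstein (d : S → S → ℝ≥0) (μ₁ μ₂ : Measure S) : ℝ≥0∞ :=
  ⨅ ξ ∈ couplings μ₁ μ₂, ∫⁻ p, (d p.1 p.2 : ℝ≥0∞) ∂ξ

/-- The Wasserstein contraction coefficient
`sup_{y₁ ≠ y₂} W(κ(y₁, ·), κ(y₂, ·)) / d(y₁, y₂)` of a transition kernel `κ`. -/
noncomputable def contractionCoeff (d : S → S → ℝ≥0) (κ : Kernel S S) : ℝ≥0∞ :=
  ⨆ (y₁ : S) (y₂ : S) (_ : y₁ ≠ y₂), wasserstein d (κ y₁) (κ y₂) / (d y₁ y₂ : ℝ≥0∞)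

/-- The eccentricity `∫ d(y, y') π(dy')` of a point `y` with respect to the measure `π`. -/
noncomputable def eccentricity (d : S → S → ℝ≥0) (π : Measure S) (y : S) : ℝ≥0∞ :=
  ∫⁻ y', (d y y' : ℝ≥0∞) ∂π

end Distance

section Family

/- Throughout, a family of transition kernels `(P_γ)_{γ ∈ I}` on `S` for which `(y, γ, A) ↦ P_γ(y, A)`
is itself a transition kernel is a `P : Kernel (S × I) S`, and `P_γ` is `P.sectL γ`. -/
variable {S I Ω : Type*} [MeasurableSpace S] [MeasurableSpace I] [MeasurableSpace Ω]

/-- Uniform Wasserstein contraction: `τ(P_γ) ≤ M` and `τ(P_γ^{k₀}) ≤ τ`, with `M ∈ [1, ∞)`,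
`τ ∈ [0, 1)` and `k₀ ≥ 1` independent of `γ`. The power `P_γ^{k₀}` is the `k₀`-step kernel. -/
def UniformContraction (d : S → S → ℝ≥0) (P : Kernel (S × I) S) : Prop :=
  ∃ (M τ : ℝ≥0) (k₀ : ℕ), 1 ≤ M ∧ τ < 1 ∧ 1 ≤ k₀ ∧
    ∀ γ : I, contractionCoeff d (P.sectL γ) ≤ M ∧ contractionCoeff d ((P.sectL γ) ^ k₀) ≤ τ

/-- Uniformly bounded eccentricity: `E_γ(y) ≤ K` for all `γ` and `y`. -/
def BoundedEccentricity (d : S → S → ℝ≥0) (π : I → Measure S) : Prop :=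
  ∃ K : ℝ≥0, 0 < K ∧ ∀ (γ : I) (y : S), eccentricity d (π γ) y ≤ K

/-- The solution `u_γ(y) = ∑_{ℓ ≥ 0} (P_γ^ℓ h(y) - π_γ(h))` of Poisson's equation. -/
noncomputable def poissonSolution (P : Kernel (S × I) S) (π : I → Measure S) (h : S → ℝ)
    (γ : I) (y : S) : ℝ :=
  ∑' ℓ : ℕ, ((∫ z, h z ∂(((P.sectL γ) ^ ℓ) y)) - ∫ z, h z ∂(π γ))

/-- The adaptation times `T_m = ∑_{j=1}^m ⌈j^β⌉`, so that `T_0 = 0`. -/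
noncomputable def adaptTime (β : ℝ) (m : ℕ) : ℕ :=
  ∑ j ∈ Finset.Icc 1 m, ⌈(j : ℝ) ^ β⌉₊

/-- `σ(Y_0, …, Y_n, Γ_0, …, Γ_n)`. -/
abbrev history (Y : ℕ → Ω → S) (Γ : ℕ → Ω → I) (n : ℕ) : MeasurableSpace Ω :=
  ⨆ i ≤ n, (MeasurableSpace.comap (Y i) inferInstance ⊔ MeasurableSpace.comap (Γ i) inferInstance)

/-- `(Y_n, Γ_n)` is an adaptive increasingly rare (AIR) MCMC chain on the probability space
`(Ω, Pr)`, driven by the family `P`, with exponent `β` and initial values `(y₀, γ₀)`. -/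
structure IsAIRChain (P : Kernel (S × I) S) (β : ℝ) (y₀ : S) (γ₀ : I)
    (Pr : Measure Ω) (Y : ℕ → Ω → S) (Γ : ℕ → Ω → I) : Prop where
  measurable_state : ∀ n, Measurable (Y n)
  measurable_param : ∀ n, Measurable (Γ n)
  init_state : ∀ ω, Y 0 ω = y₀
  init_param : ∀ ω, Γ 0 ω = γ₀
  /-- Given the past up to time `n`, the next state has the law `P_{Γ_n}(Y_n, ·)`. -/
  transition : ∀ (n : ℕ) (B : Set S), MeasurableSet B →
    Pr⟦Y (n + 1) ⁻¹' B | history Y Γ n⟧ =ᵐ[Pr] fun ω => (P (Y n ω, Γ n ω)).real B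
  /-- `Γ_n = U_n(Y_0, …, Y_n, Γ_0, …, Γ_{n-1})` with measurable update rules `U_n`. -/
  update : ∃ U : (n : ℕ) → (Fin (n + 1) → S) × (Fin n → I) → I,
    (∀ n, Measurable (U n)) ∧ ∀ n ω, Γ n ω = U n (fun i => Y i ω, fun i => Γ i ω)
  /-- The parameter is constant on each block `{T_j, …, T_{j+1} - 1}`. -/
  increasinglyRare : ∀ (j i₁ i₂ : ℕ), i₁ ∈ Set.Ico (adaptTime β j) (adaptTime β (j + 1)) →
    i₂ ∈ Set.Ico (adaptTime β j) (adaptTime β (j + 1)) → ∀ ω, Γ i₁ ω = Γ i₂ ω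

/-- The parameters at the adaptation times are (strongly) `ρ`-waning:
`k^{-ρ} ∑_{j=1}^k ‖Γ_{T_j} - Γ_{T_{j-1}}‖ → 0` almost surely, for the Euclidean norm on `ℝ^s`. -/
def IsWaning {s : ℕ} {I : Set (EuclideanSpace ℝ (Fin s))} (β ρ : ℝ)
    (Pr : Measure Ω) (Γ : ℕ → Ω → I) : Prop :=
  ∀ᵐ ω ∂Pr, Tendsto (fun k : ℕ => (1 / (k : ℝ) ^ ρ) * ∑ j ∈ Finset.Icc 1 k,
    ‖(Γ (adaptTime β j) ω : EuclideanSpace ℝ (Fin s)) - Γ (adaptTime β (j - 1)) ω‖) atTop (𝓝 0)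

end Family

end AIRMCMC

/-!
Write `h(x, φ) = f(x)` and `c = ν(f)`, which equals `π_γ(h)` for every `γ`.

A transition kernel `κ` multiplies the Lipschitz constant of a bounded function (with respect to
`d`) by at most its contraction coefficient: integrating against an arbitrary coupling suffices.
Hence the Lipschitz constant of `P_γ^ℓ h` decays geometrically, and integrating over `π_γ` with
bounded eccentricity gives `|P_γ^ℓ h - c| ≤ b_ℓ` with a summable `b` independent of `γ` and of the
state (`exists_summable_bound`). So the Poisson solutions `u_γ` are uniformly bounded, jointly
measurable, and satisfy `u_γ - P_γ u_γ = h - c` (`poissonSolution_sub_integral`).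

Summing this equation along the trajectory, the sum of `h(Y_j) - c` over `j < n` splits into

* the sum of the differences `D_j = u_{Γ_j}(Y_{j+1}) - (P_{Γ_j} u_{Γ_j})(Y_j)`. They are bounded,
  and integrate to zero against every bounded function of the past
  (`IsAIRChain.integral_mul_sub_eq_zero`). The Azuma–Hoeffding inequality bounds the probability
  that the sum exceeds `2 C √(n log n)` in modulus by `2 / n ^ 2`, where `|D_j| ≤ C`, so by
  Borel–Cantelli the sum is `O(√(n log n))` almost surely (`ae_eventually_abs_sum_le`);
* a telescoping sum, which is bounded;
* the sum of `u_{Γ_{j+1}}(Y_{j+1}) - u_{Γ_j}(Y_{j+1})`, which is at most a constant times the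
  variation of `Γ` up to time `n`. The parameter moves only at the times `T_m`, of which of the
  order of `n ^ (1 / (1 + β))` lie below `n`, so waning bounds the variation by a multiple of
  `n ^ (ρ / (1 + β)) ≤ √n` (`exists_sum_norm_sub_le_sqrt`).

The passage to the sum over `1 ≤ j ≤ n` costs the bounded term `h(Y_n) - h(Y_0)`. Everything is
`O(√(n log n))`, which is negligible against `√n (log n) ^ (1/2 + ε)`.
-/

namespace AIRMCMC

/-! ### Contraction of Lipschitz functions by transition kernels -/

section Contraction

variable {S : Type*} [MeasurableSpace S]

instance isMarkovKernel_pow (κ : Kernel S S) [IsMarkovKernel κ] (n : ℕ) :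
    IsMarkovKernel (κ ^ n) := by
  induction n with
  | zero => rw [pow_zero]; exact inferInstanceAs (IsMarkovKernel (Kernel.id : Kernel S S))
  | succ n ih => rw [pow_succ]; exact inferInstanceAs (IsMarkovKernel ((κ ^ n) ∘ₖ κ))

lemma integrable_of_abs_le {T : Type*} [MeasurableSpace T] {μ : Measure T} [IsFiniteMeasure μ]
    {g : T → ℝ} (hg : Measurable g) {C : ℝ} (hC : ∀ y, |g y| ≤ C) : Integrable g μ :=
  Integrable.of_bound hg.aestronglyMeasurable C (Eventually.of_forall hC)

lemma abs_integral_le_of_abs_le {T : Type*} [MeasurableSpace T] {μ : Measure T}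
    [IsProbabilityMeasure μ] {g : T → ℝ} {C : ℝ} (hC : ∀ y, |g y| ≤ C) : |∫ y, g y ∂μ| ≤ C := by
  simpa using norm_integral_le_of_norm_le_const (μ := μ) (f := g) (Eventually.of_forall hC)

lemma measurable_integral_kernel (κ : Kernel S S) [IsMarkovKernel κ] {g : S → ℝ}
    (hg : Measurable g) : Measurable fun y => ∫ z, g z ∂(κ y) :=
  (StronglyMeasurable.integral_kernel (κ := κ) hg.stronglyMeasurable).measurable

lemma integral_kernel_mul (κ η : Kernel S S) [IsMarkovKernel κ] [IsMarkovKernel η] {g : S → ℝ}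
    (hg : Measurable g) {C : ℝ} (hC : ∀ y, |g y| ≤ C) (y : S) :
    ∫ z, g z ∂((κ * η) y) = ∫ x, ∫ z, g z ∂(κ x) ∂(η y) := by
  change ∫ z, g z ∂((κ ∘ₖ η) y) = _
  exact Kernel.integral_comp (integrable_of_abs_le hg hC)

lemma ofReal_abs_integral_le_lintegral {T : Type*} [MeasurableSpace T] {μ : Measure T}
    {g : T → ℝ} {e : T → ℝ≥0} {L : ℝ≥0} (h : ∀ y, |g y| ≤ L * e y) :
    ENNReal.ofReal |∫ y, g y ∂μ| ≤ L * ∫⁻ y, (e y : ℝ≥0∞) ∂μ := by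
  rw [← lintegral_const_mul' _ _ ENNReal.coe_ne_top]
  refine (ENNReal.ofReal_le_of_le_toReal (norm_integral_le_lintegral_norm g)).trans ?_
  refine lintegral_mono fun y => ?_
  rw [← ENNReal.coe_mul, ← ENNReal.ofReal_coe_nnreal]
  exact ENNReal.ofReal_le_ofReal (by simpa using h y)

/-- The elementary half of Kantorovich duality; no optimal coupling is needed. -/
lemma ofReal_abs_integral_sub_le_wasserstein {d : S → S → ℝ≥0} {μ₁ μ₂ : Measure S}
    [IsProbabilityMeasure μ₁] [IsProbabilityMeasure μ₂] {g : S → ℝ} (hg : Measurable g) {C : ℝ}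
    (hC : ∀ y, |g y| ≤ C) {L : ℝ≥0} (hL : 0 < L) (hlip : ∀ y y', |g y - g y'| ≤ L * d y y') :
    ENNReal.ofReal |∫ y, g y ∂μ₁ - ∫ y, g y ∂μ₂| ≤ L * wasserstein d μ₁ μ₂ := by
  rw [wasserstein, ENNReal.mul_iInf_of_ne (by simpa using hL.ne') (by simp)]
  refine le_iInf fun ξ => ?_
  rw [ENNReal.mul_iInf_of_ne (by simpa using hL.ne') (by simp)]
  refine le_iInf fun ⟨h₁, h₂⟩ => ?_
  have hfst : Measurable fun p : S × S => g p.1 := hg.comp measurable_fst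
  have hsnd : Measurable fun p : S × S => g p.2 := hg.comp measurable_snd
  have : IsProbabilityMeasure ξ := by
    have : IsProbabilityMeasure (ξ.map Prod.fst) := h₁ ▸ inferInstance
    exact Measure.isProbabilityMeasure_of_map Prod.fst
  have e : ∫ y, g y ∂μ₁ - ∫ y, g y ∂μ₂ = ∫ p, (g p.1 - g p.2) ∂ξ := by
    rw [← h₁, ← h₂, integral_map measurable_fst.aemeasurable hg.aestronglyMeasurable,
      integral_map measurable_snd.aemeasurable hg.aestronglyMeasurable,
      integral_sub (integrable_of_abs_le hfst fun p => hC p.1)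
        (integrable_of_abs_le hsnd fun p => hC p.2)]
  rw [e]
  exact ofReal_abs_integral_le_lintegral fun p => hlip p.1 p.2

/-- A kernel multiplies Lipschitz constants with respect to `d` by its contraction coefficient. -/
lemma abs_integral_kernel_sub_le {d : S → S → ℝ≥0} (hd : ∀ y y', d y y' = 0 ↔ y = y')
    {κ : Kernel S S} [IsMarkovKernel κ] {g : S → ℝ} (hg : Measurable g) {C : ℝ}
    (hC : ∀ y, |g y| ≤ C) {L τ : ℝ≥0} (hL : 0 < L) (hτ : contractionCoeff d κ ≤ τ)
    (hlip : ∀ y y', |g y - g y'| ≤ L * d y y') (y y' : S) :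
    |∫ z, g z ∂(κ y) - ∫ z, g z ∂(κ y')| ≤ (τ * L : ℝ≥0) * d y y' := by
  rcases eq_or_ne y y' with rfl | hne
  · simp only [sub_self, abs_zero]; positivity
  have hd0 : (d y y' : ℝ≥0∞) ≠ 0 := by simpa using fun h => hne ((hd y y').1 h)
  have hW : wasserstein d (κ y) (κ y') ≤ τ * d y y' := by
    rw [← ENNReal.div_le_iff hd0 ENNReal.coe_ne_top]
    refine le_trans ?_ hτ
    exact le_iSup₂_of_le y y' (le_iSup_of_le hne le_rfl)
  have h := (ofReal_abs_integral_sub_le_wasserstein (μ₁ := κ y) (μ₂ := κ y') hg hC hL hlip).trans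
    (mul_le_mul_right hW (L : ℝ≥0∞))
  have h2 : (L : ℝ≥0∞) * (τ * d y y') = ENNReal.ofReal ((τ * L : ℝ≥0) * d y y') := by
    rw [← NNReal.coe_mul, ENNReal.ofReal_coe_nnreal]
    push_cast
    ring
  rw [h2] at h
  exact (ENNReal.ofReal_le_ofReal_iff (by positivity)).1 h

lemma integral_kernel_pow_zero (κ : Kernel S S) {g : S → ℝ} (hg : Measurable g) (y : S) :
    ∫ z, g z ∂((κ ^ 0) y) = g y := by
  change ∫ z, g z ∂(Kernel.id y) = g y
  rw [Kernel.id_apply, integral_dirac' _ _ hg.stronglyMeasurable]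

lemma abs_integral_kernel_pow_sub_le {d : S → S → ℝ≥0} (hd : ∀ y y', d y y' = 0 ↔ y = y')
    {κ : Kernel S S} [IsMarkovKernel κ] {τ : ℝ≥0} (hτ0 : 0 < τ) (hτ : contractionCoeff d κ ≤ τ)
    {C : ℝ} (n : ℕ) : ∀ {g : S → ℝ} (_ : Measurable g) (_ : ∀ y, |g y| ≤ C) {L : ℝ≥0} (_ : 0 < L)
      (_ : ∀ y y', |g y - g y'| ≤ L * d y y') (y y' : S),
    |∫ z, g z ∂((κ ^ n) y) - ∫ z, g z ∂((κ ^ n) y')| ≤ (τ ^ n * L : ℝ≥0) * d y y' := by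
  induction n with
  | zero =>
    intro g hg hC L hL hlip y y'
    have h (y : S) := integral_kernel_pow_zero κ hg y
    rw [h, h]
    simpa using hlip y y'
  | succ n ih =>
    intro g hg hC L hL hlip y y'
    rw [pow_succ', integral_kernel_mul _ _ hg hC, integral_kernel_mul _ _ hg hC]
    refine (ih (measurable_integral_kernel κ hg) (fun y => abs_integral_le_of_abs_le hC)
      (mul_pos hτ0 hL) (abs_integral_kernel_sub_le hd hg hC hL hτ hlip) y y').trans_eq ?_
    push_cast
    ring

lemma summable_pow_div {t : ℝ} (h0 : 0 ≤ t) (h1 : t < 1) {k : ℕ} (hk : 1 ≤ k) :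
    Summable fun n : ℕ => t ^ (n / k) := by
  have : NeZero k := ⟨by omega⟩
  have := Summable.mul_of_nonneg (summable_geometric_of_lt_one h0 h1)
    (Summable.of_finite (f := fun _ : Fin k => (1 : ℝ))) (fun n => pow_nonneg h0 n)
    (fun _ => zero_le_one)
  rw [← (Nat.divModEquiv k).summable_iff] at this
  simpa [Function.comp_def, Nat.divModEquiv] using this

end Contraction

/-! ### Poisson's equation -/

section Poisson

variable {S I : Type*} [MeasurableSpace S] [MeasurableSpace I]

lemma invariant_pow {κ : Kernel S S} {μ : Measure S} (h : Kernel.Invariant κ μ) (n : ℕ) :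
    Kernel.Invariant (κ ^ n) μ := by
  induction n with
  | zero => exact Measure.id_comp
  | succ n ih => rw [pow_succ]; exact ih.comp h

lemma integral_integral_of_invariant {κ : Kernel S S} [IsMarkovKernel κ] {μ : Measure S}
    [IsProbabilityMeasure μ] (h : Kernel.Invariant κ μ) {g : S → ℝ} (hg : Measurable g) {C : ℝ}
    (hC : ∀ y, |g y| ≤ C) : ∫ y, ∫ z, g z ∂(κ y) ∂μ = ∫ y, g y ∂μ := by
  have := Kernel.integral_comp (η := κ) (κ := Kernel.const Unit μ) (a := ()) (f := g)
    (integrable_of_abs_le hg hC)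
  rw [Kernel.const_apply, Kernel.comp_apply, Kernel.const_apply] at this
  rw [← this]
  congr 1

/-- Uniform contraction and bounded eccentricity make `P_γ^ℓ h(y)` converge to `π_γ(h)` at a
summable rate, uniformly in `y` and `γ`. -/
lemma exists_summable_bound {d : S → S → ℝ≥0} (hd : ∀ y y', d y y' = 0 ↔ y = y')
    {P : Kernel (S × I) S} [IsMarkovKernel P] {π : I → Measure S} [∀ γ, IsProbabilityMeasure (π γ)]
    (hπP : ∀ γ, Kernel.Invariant (P.sectL γ) (π γ)) (hcontr : UniformContraction d P)
    (hecc : BoundedEccentricity d π) {h : S → ℝ} (hh : Measurable h) {C : ℝ}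
    (hC : ∀ y, |h y| ≤ C) {L : ℝ≥0} (hL : 0 < L) (hlip : ∀ y y', |h y - h y'| ≤ L * d y y') :
    ∃ b : ℕ → ℝ, Summable b ∧ ∀ γ ℓ y,
      |(∫ z, h z ∂(((P.sectL γ) ^ ℓ) y)) - ∫ z, h z ∂(π γ)| ≤ b ℓ := by
  obtain ⟨M, τ, k₀, hM, hτ, hk, hP⟩ := hcontr
  obtain ⟨K, -, hK⟩ := hecc
  -- A positive contraction rate keeps all Lipschitz constants below positive.
  set t : ℝ≥0 := max τ 2⁻¹
  have ht0 : 0 < t := lt_max_of_lt_right (by norm_num)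
  have ht1 : t < 1 := max_lt hτ (by rw [← NNReal.coe_lt_coe]; norm_num)
  refine ⟨fun ℓ => (M ^ k₀ * L * K) * (t : ℝ) ^ (ℓ / k₀),
    (summable_pow_div t.2 (by exact_mod_cast ht1) hk).mul_left _, fun γ ℓ y => ?_⟩
  set A := P.sectL γ
  have hlipℓ (y y' : S) : |∫ z, h z ∂((A ^ ℓ) y) - ∫ z, h z ∂((A ^ ℓ) y')|
      ≤ (M ^ k₀ * L * t ^ (ℓ / k₀) : ℝ≥0) * d y y' := by
    have hℓ : A ^ ℓ = A ^ (ℓ % k₀) * (A ^ k₀) ^ (ℓ / k₀) := by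
      rw [← pow_mul, ← pow_add, Nat.mod_add_div]
    rw [hℓ, integral_kernel_mul _ _ hh hC, integral_kernel_mul _ _ hh hC]
    -- Whole blocks of `k₀` steps contract by `t`; the fewer than `k₀` remaining ones cost `M ^ k₀`.
    have hM0 : 0 < M := zero_lt_one.trans_le hM
    refine (abs_integral_kernel_pow_sub_le hd ht0
      ((hP γ).2.trans (by exact_mod_cast le_max_left _ _)) (ℓ / k₀)
      (measurable_integral_kernel _ hh) (fun y => abs_integral_le_of_abs_le hC)
      (L := M ^ (ℓ % k₀) * L) (by positivity)
      (abs_integral_kernel_pow_sub_le hd hM0 (hP γ).1 (ℓ % k₀) hh hC hL hlip) y y').trans ?_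
    gcongr ?_ * _
    rw [NNReal.coe_le_coe, mul_comm (t ^ _)]
    gcongr
    exact (Nat.mod_lt _ hk).le
  have hmeas := measurable_integral_kernel (A ^ ℓ) hh
  have e : (∫ z, h z ∂((A ^ ℓ) y)) - ∫ z, h z ∂(π γ)
      = ∫ y', (∫ z, h z ∂((A ^ ℓ) y) - ∫ z, h z ∂((A ^ ℓ) y')) ∂(π γ) := by
    rw [integral_sub (integrable_const _)
      (integrable_of_abs_le hmeas fun y => abs_integral_le_of_abs_le hC),
      integral_integral_of_invariant (invariant_pow (hπP γ) ℓ) hh hC]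
    simp
  rw [e]
  have := (ofReal_abs_integral_le_lintegral (μ := π γ) (hlipℓ y)).trans
    (mul_le_mul_right (hK γ y) _)
  rw [← ENNReal.coe_mul, ← ENNReal.ofReal_coe_nnreal,
    ENNReal.ofReal_le_ofReal_iff (by positivity)] at this
  refine this.trans_eq ?_
  push_cast
  ring

lemma measurable_integral_sectL (P : Kernel (S × I) S) [IsMarkovKernel P] {v : S × I → ℝ}
    (hv : Measurable v) : Measurable fun p : S × I => ∫ z, v (z, p.2) ∂(P p) :=
  (StronglyMeasurable.integral_kernel_prod_right' (κ := P)
    (f := fun q : (S × I) × S => v (q.2, q.1.2))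
    (hv.comp (measurable_snd.prodMk (measurable_snd.comp measurable_fst))).stronglyMeasurable
    ).measurable

lemma measurable_integral_sectL_pow (P : Kernel (S × I) S) [IsMarkovKernel P] {h : S → ℝ}
    (hh : Measurable h) {C : ℝ} (hC : ∀ y, |h y| ≤ C) (ℓ : ℕ) :
    Measurable fun p : S × I => ∫ z, h z ∂(((P.sectL p.2) ^ ℓ) p.1) := by
  induction ℓ with
  | zero =>
    simp_rw [integral_kernel_pow_zero _ hh]
    exact hh.comp measurable_fst
  | succ ℓ ih =>
    simp_rw [pow_succ, integral_kernel_mul _ _ hh hC, Kernel.sectL_apply]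
    exact measurable_integral_sectL P ih

variable {P : Kernel (S × I) S} {π : I → Measure S} {h : S → ℝ} {b : ℕ → ℝ}

lemma hasSum_poissonSolution (hb : Summable b)
    (hPb : ∀ γ ℓ y, |(∫ z, h z ∂(((P.sectL γ) ^ ℓ) y)) - ∫ z, h z ∂(π γ)| ≤ b ℓ) (γ : I) (y : S) :
    HasSum (fun ℓ => (∫ z, h z ∂(((P.sectL γ) ^ ℓ) y)) - ∫ z, h z ∂(π γ))
      (poissonSolution P π h γ y) :=
  (Summable.of_norm_bounded hb fun ℓ => hPb γ ℓ y).hasSum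

lemma abs_poissonSolution_le (hb : Summable b)
    (hPb : ∀ γ ℓ y, |(∫ z, h z ∂(((P.sectL γ) ^ ℓ) y)) - ∫ z, h z ∂(π γ)| ≤ b ℓ) (γ : I) (y : S) :
    |poissonSolution P π h γ y| ≤ ∑' ℓ, b ℓ := by
  rw [← Real.norm_eq_abs]
  exact tsum_of_norm_bounded hb.hasSum fun ℓ => hPb γ ℓ y

lemma measurable_poissonSolution [IsMarkovKernel P] (hh : Measurable h) {C : ℝ}
    (hC : ∀ y, |h y| ≤ C) {c : ℝ} (hc : ∀ γ, ∫ z, h z ∂(π γ) = c) (hb : Summable b)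
    (hPb : ∀ γ ℓ y, |(∫ z, h z ∂(((P.sectL γ) ^ ℓ) y)) - ∫ z, h z ∂(π γ)| ≤ b ℓ) :
    Measurable fun p : S × I => poissonSolution P π h p.2 p.1 := by
  refine measurable_of_tendsto_metrizable
    (f := fun n (p : S × I) => ∑ ℓ ∈ Finset.range n,
      ((∫ z, h z ∂(((P.sectL p.2) ^ ℓ) p.1)) - ∫ z, h z ∂(π p.2))) (fun n => ?_)
    (tendsto_pi_nhds.2 fun p => (hasSum_poissonSolution hb hPb p.2 p.1).tendsto_sum_nat)
  simp_rw [hc]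
  exact Finset.measurable_fun_sum _ fun ℓ _ =>
    (measurable_integral_sectL_pow P hh hC ℓ).sub_const c

/-- Poisson's equation `u_γ - P_γ u_γ = h - π_γ(h)`. -/
lemma poissonSolution_sub_integral [IsMarkovKernel P] (hh : Measurable h) {C : ℝ}
    (hC : ∀ y, |h y| ≤ C) (hb : Summable b)
    (hPb : ∀ γ ℓ y, |(∫ z, h z ∂(((P.sectL γ) ^ ℓ) y)) - ∫ z, h z ∂(π γ)| ≤ b ℓ) (γ : I) (y : S) :
    poissonSolution P π h γ y - ∫ z, poissonSolution P π h γ z ∂(P (y, γ))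
      = h y - ∫ z, h z ∂(π γ) := by
  have hm (ℓ : ℕ) : Measurable fun x => ∫ z, h z ∂(((P.sectL γ) ^ ℓ) x) :=
    measurable_integral_kernel _ hh
  have h1 : HasSum (fun ℓ => ∫ x, ((∫ z, h z ∂(((P.sectL γ) ^ ℓ) x)) - ∫ z, h z ∂(π γ)) ∂(P (y, γ)))
      (∫ z, poissonSolution P π h γ z ∂(P (y, γ))) :=
    hasSum_integral_of_dominated_convergence (fun ℓ _ => b ℓ)
      (fun ℓ => ((hm ℓ).sub_const _).aestronglyMeasurable)
      (fun ℓ => Eventually.of_forall fun x => hPb γ ℓ x) (Eventually.of_forall fun _ => hb)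
      (integrable_const _) (Eventually.of_forall fun x => hasSum_poissonSolution hb hPb γ x)
  have h2 (ℓ : ℕ) : ∫ x, ((∫ z, h z ∂(((P.sectL γ) ^ ℓ) x)) - ∫ z, h z ∂(π γ)) ∂(P (y, γ))
      = (∫ z, h z ∂(((P.sectL γ) ^ (ℓ + 1)) y)) - ∫ z, h z ∂(π γ) := by
    rw [integral_sub (integrable_of_abs_le (hm ℓ) fun x => abs_integral_le_of_abs_le hC)
      (integrable_const _), pow_succ, integral_kernel_mul _ _ hh hC, Kernel.sectL_apply]
    simp
  simp_rw [h2] at h1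
  have h3 := (hasSum_nat_add_iff' 1).2 (hasSum_poissonSolution hb hPb γ y)
  rw [h1.unique h3]
  simp only [Finset.sum_range_one]
  rw [integral_kernel_pow_zero _ hh]
  ring

end Poisson

/-! ### An Azuma–Hoeffding bound and its almost sure consequence -/

section Azuma

variable {Ω : Type*} [MeasurableSpace Ω] {Pr : Measure Ω}

/-- On `[-c, c]`, the function `x ↦ exp (l x)` lies below its chord, whose value at `0` is
`cosh (l c)`. -/
lemma exp_mul_le_cosh_add {c x : ℝ} (hc : 0 < c) (hx : |x| ≤ c) (l : ℝ) :
    Real.exp (l * x) ≤ Real.cosh (l * c) + Real.sinh (l * c) / c * x := by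
  obtain ⟨h1, h2⟩ := abs_le.1 hx
  have := convexOn_exp.2 (Set.mem_univ (l * c)) (Set.mem_univ (-(l * c)))
    (show 0 ≤ (c + x) / (2 * c) from div_nonneg (by linarith) (by linarith))
    (show 0 ≤ (c - x) / (2 * c) from div_nonneg (by linarith) (by linarith))
    (by field_simp; ring)
  simp only [smul_eq_mul] at this
  refine (le_of_eq ?_).trans (this.trans_eq ?_)
  · congr 1; field_simp; ring
  · rw [Real.cosh_eq, Real.sinh_eq]; field_simp; ring

omit [MeasurableSpace Ω] in
lemma abs_sum_range_le {D : ℕ → Ω → ℝ} {c : ℝ} (hc : ∀ n ω, |D n ω| ≤ c) (n : ℕ) (ω : Ω) :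
    |∑ j ∈ Finset.range n, D j ω| ≤ n * c :=
  (Finset.abs_sum_le_sum_abs _ _).trans
    ((Finset.sum_le_card_nsmul _ _ c fun j _ => hc j ω).trans_eq (by simp))

omit [MeasurableSpace Ω] in
lemma exp_mul_sum_le {D : ℕ → Ω → ℝ} {c : ℝ} (hc : ∀ n ω, |D n ω| ≤ c) (l : ℝ) (n : ℕ) (ω : Ω) :
    |Real.exp (l * ∑ j ∈ Finset.range n, D j ω)| ≤ Real.exp (|l| * (n * c)) := by
  rw [abs_of_pos (Real.exp_pos _), Real.exp_le_exp]
  refine (le_abs_self _).trans ?_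
  rw [abs_mul]
  gcongr
  exact abs_sum_range_le hc n ω

/-- The sub-Gaussian bound behind Azuma–Hoeffding. Of the martingale property it uses only that each
`D n` is orthogonal to the exponentials of the preceding partial sum. -/
lemma integral_exp_mul_sum_le [IsProbabilityMeasure Pr] {D : ℕ → Ω → ℝ} {c : ℝ} (hc0 : 0 < c)
    (hD : ∀ n, Measurable (D n)) (hc : ∀ n ω, |D n ω| ≤ c)
    (hmart : ∀ (l : ℝ) (n : ℕ),
      ∫ ω, Real.exp (l * ∑ j ∈ Finset.range n, D j ω) * D n ω ∂Pr = 0) (l : ℝ) (n : ℕ) :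
    ∫ ω, Real.exp (l * ∑ j ∈ Finset.range n, D j ω) ∂Pr ≤ Real.exp (n * (l * c) ^ 2 / 2) := by
  have hm (n : ℕ) : Measurable fun ω => Real.exp (l * ∑ j ∈ Finset.range n, D j ω) :=
    (measurable_const.mul (Finset.measurable_fun_sum _ fun j _ => hD j)).exp
  have hi (n : ℕ) : Integrable (fun ω => Real.exp (l * ∑ j ∈ Finset.range n, D j ω)) Pr :=
    integrable_of_abs_le (hm n) (exp_mul_sum_le hc l n)
  induction n with
  | zero => simp
  | succ n ih =>
    have hi2 : Integrable (fun ω => Real.exp (l * ∑ j ∈ Finset.range n, D j ω) * D n ω) Pr :=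
      (hi n).mul_bdd (hD n).aestronglyMeasurable (Eventually.of_forall fun ω => hc n ω)
    calc ∫ ω, Real.exp (l * ∑ j ∈ Finset.range (n + 1), D j ω) ∂Pr
        ≤ ∫ ω, (Real.cosh (l * c) * Real.exp (l * ∑ j ∈ Finset.range n, D j ω)
          + Real.sinh (l * c) / c * (Real.exp (l * ∑ j ∈ Finset.range n, D j ω) * D n ω)) ∂Pr := by
          refine integral_mono (hi _) (((hi n).const_mul _).add (hi2.const_mul _)) fun ω => ?_
          dsimp only
          rw [Finset.sum_range_succ, mul_add, Real.exp_add]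
          have := mul_le_mul_of_nonneg_left (exp_mul_le_cosh_add hc0 (hc n ω) l)
            (Real.exp_pos (l * ∑ j ∈ Finset.range n, D j ω)).le
          linarith
      _ = Real.cosh (l * c) * ∫ ω, Real.exp (l * ∑ j ∈ Finset.range n, D j ω) ∂Pr := by
          rw [integral_add ((hi n).const_mul _) (hi2.const_mul _), integral_const_mul,
            integral_const_mul, hmart]
          simp
      _ ≤ Real.exp ((l * c) ^ 2 / 2) * Real.exp (n * (l * c) ^ 2 / 2) :=
          mul_le_mul (Real.cosh_le_exp_half_sq _) ih (integral_nonneg fun _ => (Real.exp_pos _).le)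
            (Real.exp_pos _).le
      _ = _ := by rw [← Real.exp_add]; congr 1; push_cast; ring

/-- One-sided Azuma–Hoeffding inequality at the level `2 c √(n log n)`, where the optimal
exponential parameter is `2 √(log n / n) / c`. -/
lemma measureReal_sum_ge_le [IsProbabilityMeasure Pr] {D : ℕ → Ω → ℝ} {c : ℝ} (hc0 : 0 < c)
    (hD : ∀ n, Measurable (D n)) (hc : ∀ n ω, |D n ω| ≤ c)
    (hmart : ∀ (l : ℝ) (n : ℕ),
      ∫ ω, Real.exp (l * ∑ j ∈ Finset.range n, D j ω) * D n ω ∂Pr = 0) {n : ℕ} (hn : 1 ≤ n) :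
    Pr.real {ω | 2 * c * √(n * Real.log n) ≤ ∑ j ∈ Finset.range n, D j ω} ≤ 1 / (n : ℝ) ^ 2 := by
  have hn0 : (0 : ℝ) < n := by exact_mod_cast hn
  have hlog : 0 ≤ Real.log n := Real.log_natCast_nonneg n
  set q := √(n * Real.log n)
  have hq : q ^ 2 = n * Real.log n := Real.sq_sqrt (by positivity)
  set l : ℝ := 2 * q / (n * c)
  refine (measure_ge_le_exp_mul_mgf (t := l) (2 * c * q) (by positivity)
    (integrable_of_abs_le (measurable_const.mul (Finset.measurable_fun_sum _ fun j _ => hD j)).exp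
      (exp_mul_sum_le hc l n))).trans ?_
  refine (mul_le_mul_of_nonneg_left (integral_exp_mul_sum_le hc0 hD hc hmart l n)
    (Real.exp_pos _).le).trans_eq ?_
  rw [← Real.exp_add, show -l * (2 * c * q) + n * (l * c) ^ 2 / 2 = -(2 * Real.log n) by
    simp only [l]; field_simp; rw [hq]; ring, Real.exp_neg, mul_comm 2, Real.exp_mul,
    Real.exp_log hn0]
  norm_cast
  simp

/-- Borel–Cantelli: the tail bound `1 / n ^ 2` of the one-sided inequality, applied to `D` and to
`-D`, is summable. -/
lemma ae_eventually_abs_sum_le [IsProbabilityMeasure Pr] {D : ℕ → Ω → ℝ} {c : ℝ} (hc0 : 0 < c)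
    (hD : ∀ n, Measurable (D n)) (hc : ∀ n ω, |D n ω| ≤ c)
    (hmart : ∀ (l : ℝ) (n : ℕ),
      ∫ ω, Real.exp (l * ∑ j ∈ Finset.range n, D j ω) * D n ω ∂Pr = 0) :
    ∀ᵐ ω ∂Pr, ∀ᶠ n : ℕ in atTop,
      |∑ j ∈ Finset.range n, D j ω| ≤ 2 * c * √(n * Real.log n) := by
  have key (D : ℕ → Ω → ℝ) (hD : ∀ n, Measurable (D n)) (hc : ∀ n ω, |D n ω| ≤ c)
      (hmart : ∀ (l : ℝ) (n : ℕ),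
        ∫ ω, Real.exp (l * ∑ j ∈ Finset.range n, D j ω) * D n ω ∂Pr = 0) :
      ∀ᵐ ω ∂Pr, ∀ᶠ n : ℕ in atTop,
        ∑ j ∈ Finset.range n, D j ω ≤ 2 * c * √(n * Real.log n) := by
    have hs : Summable fun n : ℕ =>
        Pr.real {ω | 2 * c * √(n * Real.log n) ≤ ∑ j ∈ Finset.range n, D j ω} := by
      refine Summable.of_norm_bounded_eventually_nat
        (Real.summable_one_div_nat_pow.2 one_lt_two) ?_
      filter_upwards [eventually_ge_atTop 1] with n hn
      rw [Real.norm_of_nonneg measureReal_nonneg]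
      exact measureReal_sum_ge_le hc0 hD hc hmart hn
    have := ae_eventually_notMem (μ := Pr)
      (s := fun n : ℕ => {ω | 2 * c * √(n * Real.log n) ≤ ∑ j ∈ Finset.range n, D j ω}) (by
        have := hs.tsum_ofReal_ne_top
        simpa [Measure.real] using this)
    filter_upwards [this] with ω hω
    filter_upwards [hω] with n hn
    exact (not_le.1 hn).le
  have hneg := key (fun n ω => -D n ω) (fun n => (hD n).neg) (fun n ω => by simpa using hc n ω)
    fun l n => by simpa [integral_neg] using hmart (-l) n
  filter_upwards [key D hD hc hmart, hneg] with ω h1 h2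
  filter_upwards [h1, h2] with n h1 h2
  rw [Finset.sum_neg_distrib] at h2
  exact abs_le.2 ⟨by linarith, h1⟩

end Azuma

/-! ### Adaptation times and the variation of the parameter -/

section Variation

lemma adaptTime_succ (β : ℝ) (m : ℕ) :
    adaptTime β (m + 1) = adaptTime β m + ⌈((m + 1 : ℕ) : ℝ) ^ β⌉₊ := by
  rw [adaptTime, Finset.sum_Icc_succ_top (by omega)]; rfl

lemma adaptTime_lt_succ (β : ℝ) (m : ℕ) : adaptTime β m < adaptTime β (m + 1) := by
  rw [adaptTime_succ]
  have : 0 < ⌈((m + 1 : ℕ) : ℝ) ^ β⌉₊ := Nat.ceil_pos.2 (by positivity)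
  omega

/-- The terms `j ^ β` are at least `j k ^ (β - 1)`, and these sum to half of `k ^ β (k + 1)`. -/
lemma rpow_div_two_le_adaptTime {β : ℝ} (hβ : β ≤ 1) {k : ℕ} (hk : 1 ≤ k) :
    (k : ℝ) ^ (1 + β) / 2 ≤ adaptTime β k := by
  have hk0 : (0 : ℝ) < k := by exact_mod_cast hk
  have gauss : ∑ j ∈ Finset.Icc 1 k, (j : ℝ) = k * (k + 1) / 2 := by
    clear hk hk0
    induction k with
    | zero => simp
    | succ k ih => rw [Finset.sum_Icc_succ_top (by omega), ih]; push_cast; ring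
  have e : (k : ℝ) ^ (1 + β) = k ^ (β - 1) * (k * k) := by
    rw [show 1 + β = (β - 1) + 2 by ring, Real.rpow_add hk0, Real.rpow_two, sq]
  calc (k : ℝ) ^ (1 + β) / 2 ≤ k ^ (β - 1) * (k * (k + 1) / 2) := by
        rw [e, mul_div_assoc]; gcongr; linarith
    _ = ∑ j ∈ Finset.Icc 1 k, (k : ℝ) ^ (β - 1) * j := by rw [← Finset.mul_sum, gauss]
    _ ≤ ∑ j ∈ Finset.Icc 1 k, (⌈(j : ℝ) ^ β⌉₊ : ℝ) := by
        refine Finset.sum_le_sum fun j hj => le_trans ?_ (Nat.le_ceil _)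
        obtain ⟨h1, h2⟩ := Finset.mem_Icc.1 hj
        have hj0 : (0 : ℝ) < j := by exact_mod_cast h1
        calc (k : ℝ) ^ (β - 1) * j ≤ (j : ℝ) ^ (β - 1) * j := by
              refine mul_le_mul_of_nonneg_right ?_ hj0.le
              exact Real.rpow_le_rpow_of_nonpos hj0 (by exact_mod_cast h2) (by linarith)
          _ = (j : ℝ) ^ β := by rw [← Real.rpow_add_one hj0.ne']; congr 1; ring
    _ = adaptTime β k := by rw [adaptTime]; push_cast; rfl

variable {E : Type*} [SeminormedAddCommGroup E]

lemma sum_range_adaptTime_norm_sub {β : ℝ} {G : ℕ → E}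
    (hG : ∀ j i₁ i₂ : ℕ, i₁ ∈ Set.Ico (adaptTime β j) (adaptTime β (j + 1)) →
      i₂ ∈ Set.Ico (adaptTime β j) (adaptTime β (j + 1)) → G i₁ = G i₂) (k : ℕ) :
    ∑ i ∈ Finset.range (adaptTime β k), ‖G (i + 1) - G i‖
      = ∑ j ∈ Finset.Icc 1 k, ‖G (adaptTime β j) - G (adaptTime β (j - 1))‖ := by
  induction k with
  | zero => simp [adaptTime]
  | succ k ih =>
    have hlt := adaptTime_lt_succ β k
    rw [Finset.sum_Icc_succ_top (by omega), ← ih,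
      ← Finset.sum_range_add_sum_Ico _ hlt.le, Nat.add_sub_cancel]
    congr 1
    -- Inside the block only the last step changes the parameter.
    obtain ⟨m, hm⟩ : ∃ m, adaptTime β (k + 1) = m + 1 := ⟨_, (Nat.succ_pred (by omega)).symm⟩
    rw [hm, Finset.sum_Ico_succ_top (by omega), Finset.sum_eq_zero, zero_add,
      hG k m (adaptTime β k) ⟨by omega, by omega⟩ ⟨le_rfl, hlt⟩]
    intro i hi
    obtain ⟨h1, h2⟩ := Finset.mem_Ico.1 hi
    rw [hG k (i + 1) i ⟨by omega, by omega⟩ ⟨by omega, by omega⟩, sub_self, norm_zero]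

/-- Since `T_k ≥ k ^ (1 + β) / 2`, at most of the order of `n ^ (1 / (1 + β))` adaptations occur
before time `n`, and `ρ / (1 + β) ≤ 1 / 2`. -/
lemma exists_sum_norm_sub_le_sqrt {β ρ : ℝ} (hβ0 : 0 < β) (hβ1 : β < 1) (hρ0 : 0 < ρ)
    (hβρ : 2 * ρ - 1 ≤ β) {G : ℕ → E}
    (hG : ∀ j i₁ i₂ : ℕ, i₁ ∈ Set.Ico (adaptTime β j) (adaptTime β (j + 1)) →
      i₂ ∈ Set.Ico (adaptTime β j) (adaptTime β (j + 1)) → G i₁ = G i₂)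
    (hw : Tendsto (fun k : ℕ => (1 / (k : ℝ) ^ ρ) * ∑ j ∈ Finset.Icc 1 k,
      ‖G (adaptTime β j) - G (adaptTime β (j - 1))‖) atTop (𝓝 0)) :
    ∃ C : ℝ, 0 ≤ C ∧ ∀ n : ℕ, 1 ≤ n →
      ∑ i ∈ Finset.range n, ‖G (i + 1) - G i‖ ≤ C * √n := by
  obtain ⟨C, hC⟩ := hw.bddAbove_range
  refine ⟨max C 0 * (2 ^ ρ * √2), by positivity, fun n hn => ?_⟩
  have hn1 : (1 : ℝ) ≤ n := by exact_mod_cast hn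
  set x : ℝ := (2 * n : ℝ) ^ (1 / (1 + β))
  have hx1 : 1 ≤ x := Real.one_le_rpow (by linarith) (by positivity)
  set k := ⌈x⌉₊
  have hxk : x ≤ k := Nat.le_ceil x
  have hk2 : (k : ℝ) ≤ 2 * x := by linarith [Nat.ceil_lt_add_one (zero_le_one.trans hx1)]
  have hk0 : (0 : ℝ) < k := by linarith
  have hk : 1 ≤ k := by exact_mod_cast hk0
  have hnT : n ≤ adaptTime β k := by
    have h1 : x ^ (1 + β) = 2 * n := by
      rw [← Real.rpow_mul (by positivity), one_div_mul_cancel (by positivity), Real.rpow_one]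
    have h2 : x ^ (1 + β) ≤ (k : ℝ) ^ (1 + β) := by gcongr
    have h3 := rpow_div_two_le_adaptTime hβ1.le hk
    have : (n : ℝ) ≤ adaptTime β k := by linarith
    exact_mod_cast this
  have hxρ : x ^ ρ ≤ √2 * √n := by
    rw [← Real.rpow_mul (by positivity), ← Real.sqrt_mul (by positivity), Real.sqrt_eq_rpow]
    refine Real.rpow_le_rpow_of_exponent_le (by linarith) ?_
    rw [div_mul_eq_mul_div, one_mul, div_le_div_iff₀ (by positivity) (by positivity)]
    linarith
  calc ∑ i ∈ Finset.range n, ‖G (i + 1) - G i‖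
      ≤ ∑ i ∈ Finset.range (adaptTime β k), ‖G (i + 1) - G i‖ :=
        Finset.sum_le_sum_of_subset_of_nonneg (Finset.range_mono hnT) fun _ _ _ => norm_nonneg _
    _ = ∑ j ∈ Finset.Icc 1 k, ‖G (adaptTime β j) - G (adaptTime β (j - 1))‖ :=
        sum_range_adaptTime_norm_sub hG k
    _ ≤ max C 0 * (k : ℝ) ^ ρ := by
        have := (hC ⟨k, rfl⟩).trans (le_max_left C 0)
        dsimp only at this
        rwa [one_div_mul_eq_div, div_le_iff₀ (by positivity)] at this
    _ ≤ max C 0 * (2 * x) ^ ρ := by gcongr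
    _ = max C 0 * (2 ^ ρ * x ^ ρ) := by rw [Real.mul_rpow (by positivity) (by positivity)]
    _ ≤ max C 0 * (2 ^ ρ * (√2 * √n)) := by gcongr
    _ = _ := by ring

end Variation

/-! ### The normalizing sequence -/

section Normalization

/-- Any sequence of order `√(n log n)` is negligible against `√n (log n) ^ (1/2 + ε)`. -/
lemma tendsto_normalized_zero {a : ℕ → ℝ} {C ε : ℝ} (hε : 0 < ε)
    (ha : ∀ᶠ n : ℕ in atTop, |a n| ≤ C * √(n * Real.log n)) :
    Tendsto (fun n : ℕ => (1 / (√(n : ℝ) * Real.log n ^ (1 / 2 + ε))) * a n) atTop (𝓝 0) := by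
  have hlim : Tendsto (fun n : ℕ => C * Real.log n ^ (-ε)) atTop (𝓝 0) := by
    simpa using ((tendsto_rpow_neg_atTop hε).comp
      (Real.tendsto_log_atTop.comp tendsto_natCast_atTop_atTop)).const_mul C
  refine squeeze_zero_norm' ?_ hlim
  filter_upwards [ha, eventually_gt_atTop 1] with n hn hn1
  have hn1' : (1 : ℝ) < n := by exact_mod_cast hn1
  have hlog : 0 < Real.log n := Real.log_pos hn1'
  have hq : 0 < √(n : ℝ) := Real.sqrt_pos.2 (by linarith)
  rw [Real.norm_eq_abs, abs_mul, abs_of_nonneg (by positivity), one_div_mul_eq_div,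
    div_le_iff₀ (by positivity)]
  refine hn.trans_eq ?_
  rw [Real.sqrt_mul (by linarith), Real.sqrt_eq_rpow (Real.log n),
    show (1 / 2 : ℝ) = -ε + (1 / 2 + ε) by ring, Real.rpow_add hlog]
  ring_nf

end Normalization

/-! ### The martingale property of the chain -/

section Transition

/-- If `κ (T ω)` is the conditional law of `Z` given `T`, integrals of functions of `(T, Z)` are
iterated integrals. -/
lemma integral_comp_prodMk_eq {Ω Ω' S : Type*} [MeasurableSpace Ω] [MeasurableSpace Ω']
    [MeasurableSpace S] {μ : Measure Ω} [IsFiniteMeasure μ] {T : Ω → Ω'} (hT : Measurable T)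
    {Z : Ω → S} (hZ : Measurable Z) {κ : Kernel Ω' S} [IsMarkovKernel κ]
    (h : ∀ A B, MeasurableSet A → MeasurableSet B →
      μ (T ⁻¹' A ∩ Z ⁻¹' B) = ∫⁻ ω in T ⁻¹' A, κ (T ω) B ∂μ)
    {w : Ω' × S → ℝ} (hw : Measurable w) {C : ℝ} (hC : ∀ p, |w p| ≤ C) :
    ∫ ω, w (T ω, Z ω) ∂μ = ∫ ω, ∫ z, w (T ω, z) ∂(κ (T ω)) ∂μ := by
  have e : μ.map (fun ω => (T ω, Z ω)) = (μ.map T) ⊗ₘ κ := by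
    refine Measure.ext_prod fun {A B} hA hB => ?_
    rw [Measure.map_apply (hT.prodMk hZ) (hA.prod hB), Measure.compProd_apply_prod hA hB,
      setLIntegral_map hA (κ.measurable_coe hB) hT, ← h A B hA hB]
    rfl
  rw [← integral_map (hT.prodMk hZ).aemeasurable hw.aestronglyMeasurable, e,
    Measure.integral_compProd (integrable_of_abs_le hw hC),
    integral_map hT.aemeasurable
      (StronglyMeasurable.integral_kernel_prod_right' (κ := κ)
        hw.stronglyMeasurable).aestronglyMeasurable]

variable {S I Ω : Type*} [MeasurableSpace S] [MeasurableSpace I] [MeasurableSpace Ω]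
  {P : Kernel (S × I) S} {β : ℝ} {y₀ : S} {γ₀ : I} {Pr : Measure Ω} {Y : ℕ → Ω → S} {Γ : ℕ → Ω → I}

omit [MeasurableSpace Ω] in
lemma measurable_state_history (Y : ℕ → Ω → S) (Γ : ℕ → Ω → I) {i n : ℕ} (hi : i ≤ n) :
    Measurable[history Y Γ n] (Y i) :=
  measurable_iff_comap_le.2 (le_trans le_sup_left
    (le_iSup₂_of_le (f := fun i (_ : i ≤ n) => MeasurableSpace.comap (Y i) inferInstance ⊔
      MeasurableSpace.comap (Γ i) inferInstance) i hi le_rfl))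

omit [MeasurableSpace Ω] in
lemma measurable_param_history (Y : ℕ → Ω → S) (Γ : ℕ → Ω → I) {i n : ℕ} (hi : i ≤ n) :
    Measurable[history Y Γ n] (Γ i) :=
  measurable_iff_comap_le.2 (le_trans le_sup_right
    (le_iSup₂_of_le (f := fun i (_ : i ≤ n) => MeasurableSpace.comap (Y i) inferInstance ⊔
      MeasurableSpace.comap (Γ i) inferInstance) i hi le_rfl))

lemma IsAIRChain.history_le (hchain : IsAIRChain P β y₀ γ₀ Pr Y Γ) (n : ℕ) :
    history Y Γ n ≤ ‹MeasurableSpace Ω› :=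
  iSup₂_le fun i _ => sup_le (hchain.measurable_state i).comap_le (hchain.measurable_param i).comap_le

/-- The transition law in integrated form, free of conditional expectations. -/
lemma IsAIRChain.measure_inter [IsProbabilityMeasure Pr] [IsMarkovKernel P]
    (hchain : IsAIRChain P β y₀ γ₀ Pr Y Γ) (n : ℕ) {A : Set Ω} {B : Set S}
    (hA : MeasurableSet[history Y Γ n] A) (hB : MeasurableSet B) :
    Pr (A ∩ Y (n + 1) ⁻¹' B) = ∫⁻ ω in A, P (Y n ω, Γ n ω) B ∂Pr := by
  have hle := hchain.history_le n
  have hYB : MeasurableSet (Y (n + 1) ⁻¹' B) := hchain.measurable_state (n + 1) hB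
  have hPm : Measurable fun ω => P (Y n ω, Γ n ω) B :=
    (P.measurable_coe hB).comp ((hchain.measurable_state n).prodMk (hchain.measurable_param n))
  have h1 : ∫ ω in A, (P (Y n ω, Γ n ω)).real B ∂Pr = Pr.real (A ∩ Y (n + 1) ⁻¹' B) := by
    rw [← setIntegral_congr_ae (hle _ hA)
      ((hchain.transition n B hB).mono fun ω h _ => h),
      setIntegral_condExp hle ((integrable_const (1 : ℝ)).indicator hYB) hA,
      setIntegral_indicator hYB]
    simp
  have h2 : ∫ ω in A, (P (Y n ω, Γ n ω)).real B ∂Pr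
      = (∫⁻ ω in A, P (Y n ω, Γ n ω) B ∂Pr).toReal :=
    integral_toReal hPm.aemeasurable (Eventually.of_forall fun _ => measure_lt_top _ _)
  have h3 : ∫⁻ ω in A, P (Y n ω, Γ n ω) B ∂Pr ≠ ∞ := by
    refine ((lintegral_mono fun ω => prob_le_one).trans_lt ?_).ne
    simp
  rw [← ENNReal.toReal_eq_toReal_iff' (measure_ne_top _ _) h3, ← h2, h1]
  rfl

/-- `v(Y_{n+1}, Γ_n) - (P_{Γ_n} v(·, Γ_n))(Y_n)` is a martingale difference. -/
lemma IsAIRChain.integral_mul_sub_eq_zero [IsProbabilityMeasure Pr] [IsMarkovKernel P]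
    (hchain : IsAIRChain P β y₀ γ₀ Pr Y Γ) {v : S × I → ℝ} (hv : Measurable v) {C : ℝ}
    (hC : ∀ p, |v p| ≤ C) (n : ℕ) {g : Ω → ℝ} (hg : Measurable[history Y Γ n] g) {A : ℝ}
    (hA : ∀ ω, |g ω| ≤ A) :
    ∫ ω, g ω * (v (Y (n + 1) ω, Γ n ω) - ∫ z, v (z, Γ n ω) ∂(P (Y n ω, Γ n ω))) ∂Pr = 0 := by
  have hle := hchain.history_le n
  have hYΓ : Measurable[history Y Γ n] fun ω => (Y n ω, Γ n ω) :=
    (measurable_state_history Y Γ le_rfl).prodMk (measurable_param_history Y Γ le_rfl)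
  have hPv := measurable_integral_sectL P hv
  -- The conditioning map `T` is the identity from `Ω` to `Ω` with the `σ`-algebra of the past, so
  -- the second `σ`-algebra on `Ω` has to be passed explicitly.
  have key := @integral_comp_prodMk_eq Ω Ω S _ (history Y Γ n) _ Pr _ id
    (measurable_id'' hle) (Y (n + 1)) (hchain.measurable_state _)
    (@Kernel.comap _ _ _ _ _ (history Y Γ n) P (fun ω => (Y n ω, Γ n ω)) hYΓ)
    (@Kernel.IsMarkovKernel.comap _ _ _ _ _ (history Y Γ n) _ P _ hYΓ)
    (fun A B hA hB => hchain.measure_inter n hA hB)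
    (fun p => g p.1 * (v (p.2, Γ n p.1) - ∫ z, v (z, Γ n p.1) ∂(P (Y n p.1, Γ n p.1))))
    (by
      let _ := history Y Γ n
      exact (hg.comp measurable_fst).mul ((hv.comp (measurable_snd.prodMk
        ((measurable_param_history Y Γ le_rfl).comp measurable_fst))).sub
        (hPv.comp (hYΓ.comp measurable_fst))))
    (A * (C + C)) (fun p => by
      rw [abs_mul]
      refine mul_le_mul (hA _) ((abs_sub _ _).trans (add_le_add (hC _)
        (abs_integral_le_of_abs_le fun z => hC _))) (abs_nonneg _) ((abs_nonneg _).trans (hA p.1)))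
  refine key.trans ?_
  refine integral_eq_zero_of_ae (Eventually.of_forall fun ω => ?_)
  change ∫ z, g ω * (v (z, Γ n ω) - ∫ z, v (z, Γ n ω) ∂(P (Y n ω, Γ n ω))) ∂(P (Y n ω, Γ n ω)) = 0
  have hint : Integrable (fun z => v (z, Γ n ω)) (P (Y n ω, Γ n ω)) :=
    integrable_of_abs_le (hv.comp (measurable_id.prodMk measurable_const)) fun z => hC _
  rw [integral_const_mul, integral_sub hint (integrable_const _)]
  simp

end Transition

end AIRMCMC

/-! ### The almost sure rate -/

theorem mainTheorem4
    -- state space `X`, auxiliary space `Φ`; the augmented space `X × Φ` carries a Polish topology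
    {X Φ : Type*} [MeasurableSpace X] [StandardBorelSpace X]
    [MeasurableSpace Φ] [StandardBorelSpace Φ]
    [TopologicalSpace (X × Φ)] [PolishSpace (X × Φ)] [BorelSpace (X × Φ)]
    -- parameter space
    {s : ℕ} {I : Set (EuclideanSpace ℝ (Fin s))}
    -- target distribution, kernels, and invariant distributions with marginal `ν`
    (ν : Measure X) [IsProbabilityMeasure ν]
    (P : Kernel ((X × Φ) × I) (X × Φ)) [IsMarkovKernel P]
    (π : I → Measure (X × Φ)) [∀ γ, IsProbabilityMeasure (π γ)]
    (hπν : ∀ γ, (π γ).map Prod.fst = ν)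
    (hπP : ∀ γ, Kernel.Invariant (P.sectL γ) (π γ))
    -- contraction and bounded eccentricity for a distance-like function
    (d : X × Φ → X × Φ → ℝ≥0) (hd : AIRMCMC.IsDistanceLike d)
    (hcontr : AIRMCMC.UniformContraction d P)
    (hecc : AIRMCMC.BoundedEccentricity d π)
    -- the integrand: `h(x, φ) = f(x)` is Lipschitz with respect to `d` and bounded
    (f : X → ℝ) (hf : Measurable f)
    (hfLip : ∃ L : ℝ, 0 < L ∧ ∀ y y' : X × Φ, |f y.1 - f y'.1| ≤ L * d y y')
    (hfBdd : ∃ C : ℝ, ∀ y : X × Φ, |f y.1| ≤ C)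
    -- the Poisson solutions are uniformly Lipschitz in the parameter
    (hpoisson : ∃ Λ : ℝ, 0 < Λ ∧ ∀ (γ γ' : I) (y : X × Φ),
      |AIRMCMC.poissonSolution P π (fun z => f z.1) γ y
        - AIRMCMC.poissonSolution P π (fun z => f z.1) γ' y|
        ≤ Λ * ‖(γ : EuclideanSpace ℝ (Fin s)) - γ'‖)
    -- the AIR chain, with waning parameters
    (β ρ : ℝ) (hβ0 : 0 < β) (hβ1 : β < 1) (hρ0 : 0 < ρ) (hρ1 : ρ < 1) (hβρ : 2 * ρ - 1 ≤ β)
    {Ω : Type*} [MeasurableSpace Ω] (Pr : Measure Ω) [IsProbabilityMeasure Pr]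
    (y₀ : X × Φ) (γ₀ : I) (Y : ℕ → Ω → X × Φ) (Γ : ℕ → Ω → I)
    (hchain : AIRMCMC.IsAIRChain P β y₀ γ₀ Pr Y Γ)
    (hwaning : AIRMCMC.IsWaning β ρ Pr Γ)
    (ε : ℝ) (hε : 0 < ε) :
    ∀ᵐ ω ∂Pr, Tendsto
      (fun n : ℕ => (1 / (√(n : ℝ) * Real.log n ^ (1 / 2 + ε))) *
        ∑ j ∈ Finset.Icc 1 n, (f (Y j ω).1 - ∫ x, f x ∂ν))
      atTop (𝓝 0) := by
  obtain ⟨L, hL, hlip⟩ := hfLip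
  obtain ⟨C, hC⟩ := hfBdd
  obtain ⟨Λ, hΛ, hΛu⟩ := hpoisson
  set h : X × Φ → ℝ := fun z => f z.1
  have hh : Measurable h := hf.comp measurable_fst
  have hc (γ : I) : ∫ z, h z ∂(π γ) = ∫ x, f x ∂ν := by
    rw [← hπν γ, integral_map measurable_fst.aemeasurable hf.aestronglyMeasurable]
  obtain ⟨b, hb, hPb⟩ := AIRMCMC.exists_summable_bound hd.eq_zero_iff hπP hcontr hecc hh hC
    (L := ⟨L, hL.le⟩) hL hlip
  set v : (X × Φ) × I → ℝ := fun p => AIRMCMC.poissonSolution P π h p.2 p.1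
  have hv : Measurable v := AIRMCMC.measurable_poissonSolution hh hC hc hb hPb
  -- The maximum with `1` makes the bound positive, as the Azuma–Hoeffding estimate requires.
  set B : ℝ := max (∑' ℓ, b ℓ) 1
  have hB0 : 0 < B := lt_max_of_lt_right one_pos
  have hvB (p : (X × Φ) × I) : |v p| ≤ B :=
    (AIRMCMC.abs_poissonSolution_le hb hPb p.2 p.1).trans (le_max_left _ _)
  have hPv := AIRMCMC.measurable_integral_sectL P hv
  set D : ℕ → Ω → ℝ := fun n ω =>
    v (Y (n + 1) ω, Γ n ω) - ∫ z, v (z, Γ n ω) ∂(P (Y n ω, Γ n ω))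
  have hDhist {j n : ℕ} (hj : j < n) : Measurable[AIRMCMC.history Y Γ n] (D j) :=
    (hv.comp ((AIRMCMC.measurable_state_history Y Γ hj).prodMk
      (AIRMCMC.measurable_param_history Y Γ hj.le))).sub
    (hPv.comp ((AIRMCMC.measurable_state_history Y Γ hj.le).prodMk
      (AIRMCMC.measurable_param_history Y Γ hj.le)))
  have hDB (n : ℕ) (ω : Ω) : |D n ω| ≤ 2 * B := by
    rw [two_mul]
    exact (abs_sub _ _).trans (add_le_add (hvB _) (AIRMCMC.abs_integral_le_of_abs_le fun z => hvB _))
  have hmart (l : ℝ) (n : ℕ) :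
      ∫ ω, Real.exp (l * ∑ j ∈ Finset.range n, D j ω) * D n ω ∂Pr = 0 :=
    hchain.integral_mul_sub_eq_zero hv hvB n
      (Real.measurable_exp.comp (measurable_const.mul
        (Finset.measurable_fun_sum _ fun j hj => hDhist (Finset.mem_range.1 hj))))
      (AIRMCMC.exp_mul_sum_le hDB l n)
  have hAzuma := AIRMCMC.ae_eventually_abs_sum_le (Pr := Pr) (by positivity : 0 < 2 * B)
    (fun n => (hDhist n.lt_succ_self).mono (hchain.history_le _) le_rfl) hDB hmart
  filter_upwards [hAzuma, hwaning] with ω hS hw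
  obtain ⟨V, hV0, hV⟩ := AIRMCMC.exists_sum_norm_sub_le_sqrt (ρ := ρ) hβ0 hβ1 hρ0 hβρ
    (G := fun n => (Γ n ω : EuclideanSpace ℝ (Fin s)))
    (fun j i₁ i₂ h₁ h₂ => congrArg Subtype.val (hchain.increasinglyRare j i₁ i₂ h₁ h₂ ω)) hw
  refine AIRMCMC.tendsto_normalized_zero (C := 2 * (2 * B) + 2 * B + Λ * V + 2 * C) hε ?_
  filter_upwards [hS, eventually_ge_atTop 3] with n hSn hn
  -- Poisson's equation, summed along the trajectory.
  have hstep (j : ℕ) : h (Y j ω) - ∫ x, f x ∂ν = D j ω + (v (Y j ω, Γ j ω)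
      - v (Y (j + 1) ω, Γ (j + 1) ω)) + (v (Y (j + 1) ω, Γ (j + 1) ω) - v (Y (j + 1) ω, Γ j ω)) := by
    rw [← hc (Γ j ω), ← AIRMCMC.poissonSolution_sub_integral hh hC hb hPb]
    simp only [D, v]
    ring
  have hsum : ∑ j ∈ Finset.Icc 1 n, (f (Y j ω).1 - ∫ x, f x ∂ν)
      = ∑ j ∈ Finset.range n, D j ω + (v (Y 0 ω, Γ 0 ω) - v (Y n ω, Γ n ω))
        + ∑ j ∈ Finset.range n, (v (Y (j + 1) ω, Γ (j + 1) ω) - v (Y (j + 1) ω, Γ j ω))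
        + (h (Y n ω) - h (Y 0 ω)) := by
    have h1 : ∑ j ∈ Finset.Icc 1 n, (f (Y j ω).1 - ∫ x, f x ∂ν)
        = ∑ j ∈ Finset.range n, (h (Y j ω) - ∫ x, f x ∂ν) + (h (Y n ω) - h (Y 0 ω)) := by
      have := Finset.sum_range_succ' (fun j => h (Y j ω) - ∫ x, f x ∂ν) n
      rw [Finset.sum_range_succ] at this
      rw [← Finset.Ico_succ_right_eq_Icc, Order.succ_eq_add_one, Finset.sum_Ico_eq_sum_range,
        Nat.add_sub_cancel]
      simp only [add_comm 1]
      linarith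
    rw [h1, Finset.sum_congr rfl fun j _ => hstep j, Finset.sum_add_distrib,
      Finset.sum_add_distrib, Finset.sum_range_sub' (fun j => v (Y j ω, Γ j ω))]
  -- The remaining sum is controlled by the variation of the parameter.
  have hvar : |∑ j ∈ Finset.range n, (v (Y (j + 1) ω, Γ (j + 1) ω) - v (Y (j + 1) ω, Γ j ω))|
      ≤ Λ * (V * √n) := by
    refine (Finset.abs_sum_le_sum_abs _ _).trans ((Finset.sum_le_sum fun j _ =>
      hΛu (Γ (j + 1) ω) (Γ j ω) (Y (j + 1) ω)).trans ?_)
    rw [← Finset.mul_sum]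
    exact mul_le_mul_of_nonneg_left (hV n (by omega)) hΛ.le
  have hn3 : (3 : ℝ) ≤ n := by exact_mod_cast hn
  have hlog : 1 ≤ Real.log n := by
    rw [Real.le_log_iff_exp_le (by linarith)]
    linarith [Real.exp_one_lt_three]
  have hq1 : √(n : ℝ) ≤ √(n * Real.log n) := Real.sqrt_le_sqrt (by nlinarith)
  have hq2 : 1 ≤ √(n * Real.log n) := le_trans (Real.one_le_sqrt.2 (by linarith)) hq1
  have hC0 : 0 ≤ C := (abs_nonneg _).trans (hC y₀)
  have e1 : B * 1 ≤ B * √(n * Real.log n) := by gcongr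
  have e2 : C * 1 ≤ C * √(n * Real.log n) := by gcongr
  have e3 : Λ * (V * √n) ≤ Λ * (V * √(n * Real.log n)) := by gcongr
  have b1 := abs_le.1 (hvB (Y 0 ω, Γ 0 ω))
  have b2 := abs_le.1 (hvB (Y n ω, Γ n ω))
  have b3 : |h (Y n ω)| ≤ C := hC _
  have b4 : |h (Y 0 ω)| ≤ C := hC _
  rw [abs_le] at b3 b4 hSn hvar
  rw [hsum, abs_le]
  constructor <;> linarith
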